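/- Let $d\ge 1$. **Hilbert curve.** For each level $m\ge 0$ divide $[0,1]^d$ into its $2^{dm}$ closed dyadic subcubes of side $2^{-m}$, and let $S_m(0),\dots,S_m(2^{dm}-1)$ be enumerations of these subcubes such that, for all $m$: $S_{m+1}(2^dk),\dots,S_{m+1}(2^dk+2^d-1)$ are the $2^d$ halves of $S_m(k)$ (nesting); $S_m(k)$ and $S_m(k+1)$ share a $(d-1)$-dimensional face (adjacency); and $0\in S_m(0)$. The associated Hilbert curve $H:[0,1]\to[0,1]^d$ is the pointwise limit, as $m\to\infty$, of the functions that take the value "centre of $S_m(k)$" on the $k$-th of the $2^{dm}$ successive subintervals of $[0,1]$ of length $2^{-dm}$; in particular $H(0)=(0,\dots,0)$, and $H$ is the identity if $d=1$. Let $h:[0,1]^d\to[0,1]$ be a one-to-one Borel measurable map with $H(h(x))=x$ for all $x\in[0,1]^d$. **State space.** Let $\mathcal X=\prod_{i=1}^d\mathcal X_i\subseteq\mathbb R^d$ with $\mathcal X_i\subseteq\mathbb R$ measurable, let $\psi_i:\mathcal X_i\to(0,1)$ be strictly increasing bijections with continuously differentiable inverses, and let $\psi_{\mathcal X}(x)=(\psi_1(x_1),\dots,\psi_d(x_d))$,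 a bijection from $\mathcal X$ onto $(0,1)^d$. **Hilbert-ordered stratified resampling.** Let $N\ge 1$ and let $z=(x^n,w^n)_{n=1}^N$ with $x^n\in\mathcal X$, $w^n\ge 0$ and $\sum_{n=1}^N w^n=1$. Let $\sigma$ be a permutation of $\{1,\dots,N\}$ such that $h(\psi_{\mathcal X}(x^{\sigma(1)}))\le\dots\le h(\psi_{\mathcal X}(x^{\sigma(N)}))$. For $u\in[0,1]$ let $F^-(u)$ be the least $n\in\{1,\dots,N\}$ with $\sum_{m=1}^n w^{\sigma(m)}\ge u$. With $U_1,U_2,\dots$ independent random variables, each uniformly distributed on $[0,1]$, put $$\rho^*_{\mathrm{strat}}(z)=\frac1N\sum_{n=1}^N\delta_{x^{\sigma(A^n)}},\qquad A^n=F^-\Big(\frac{n-1+U_n}{N}\Big),$$ and write $\rho^*_{\mathrm{strat}}(z)(\varphi)$ for the integral of $\varphi$ with respect to this random measure. **Theorem.** Let $\varphi:\mathcal X\to\mathbb R$ be measurable, and let $C\in\mathbb R$ and $\gamma\in(0,1]$ be such that $$\big|\varphi\circ\psi_{\mathcal X}^{-1}(x)-\varphi\circ\psi_{\mathcal X}^{-1}(y)\big|\le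 C\,\|x-y\|_2^{\gamma}\qquad\text{for all }x,y\in(0,1)^d.$$ Then, for every $N\ge1$ and every $z$ as above, $\rho^*_{\mathrm{strat}}(z)(\varphi)$ is square-integrable and $$\mathrm{Var}\big[\rho^*_{\mathrm{strat}}(z)(\varphi)\big]\le\big(2\sqrt{d+3}\big)^{2\gamma}\,\frac{C^2}{N^{1+\gamma/d}}.$$ -/

import Mathlib

open MeasureTheory ProbabilityTheory Filter Topology
open scoped ENNReal unitInterval

noncomputable section

/-! ## Cubes -/

/-- The closed unit cube `[0,1]^d`. -/
def closedCube (d : ℕ) : Set (EuclideanSpace ℝ (Fin d)) := {x | ∀ i, x i ∈ Set.Icc (0 : ℝ) 1}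

/-- The open unit cube `(0,1)^d`. -/
def openCube (d : ℕ) : Set (EuclideanSpace ℝ (Fin d)) := {x | ∀ i, x i ∈ Set.Ioo (0 : ℝ) 1}

theorem openCube_subset_closedCube (d : ℕ) : openCube d ⊆ closedCube d :=
  fun _ hx i => Set.Ioo_subset_Icc_self (hx i)

/-! ## The Hilbert space-filling curve -/

/-- The combinatorial data of a Hilbert curve in dimension `d`: for every level `m`, the order in
which the curve runs through the `2^(d*m)` dyadic subcubes of side `2^(-m)` of `[0,1]^d`. The
subcube `∏ i, [c i / 2^m, (c i + 1) / 2^m]` is encoded by `c`, and `cell m k` is the `k`-th subcube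
visited (`k = 0, ..., 2^(d*m) - 1`; other values of `k` are irrelevant). For `d = 1` the axioms
force `cell m k = k`; for `d ≥ 2` they leave some freedom. -/
structure HilbertOrdering (d : ℕ) where
  cell : ℕ → ℕ → Fin d → ℕ
  /-- Each subcube is visited exactly once. -/
  bijOn : ∀ m, Set.BijOn (cell m) (Set.Iio (2 ^ (d * m))) {c | ∀ i, c i < 2 ^ m}
  /-- Nesting: the subcubes number `2^d * k, ..., 2^d * k + 2^d - 1` of level `m + 1` are
  the `2^d` halves of the subcube number `k` of level `m`. -/
  nested : ∀ m k, k < 2 ^ (d * (m + 1)) → ∀ i, cell (m + 1) k i / 2 = cell m (k / 2 ^ d) i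
  /-- Adjacency: consecutive subcubes share a `(d-1)`-dimensional face. -/
  adjacent : ∀ m k, k + 1 < 2 ^ (d * m) → ∃ i,
    (cell m (k + 1) i = cell m k i + 1 ∨ cell m k i = cell m (k + 1) i + 1) ∧
    ∀ j, j ≠ i → cell m (k + 1) j = cell m k j
  /-- The curve starts at the origin. -/
  start : ∀ m, cell m 0 = 0

namespace HilbertOrdering

variable {d : ℕ}

/-- The index `k` of an interval `[k / 2^(d*m), (k+1) / 2^(d*m)]` containing `t ∈ [0,1]`. -/
def index (d m : ℕ) (t : I) : ℕ := min ⌊(t : ℝ) * 2 ^ (d * m)⌋₊ (2 ^ (d * m) - 1)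

/-- The `m`-th approximation of the Hilbert curve: during the `k`-th of the `2^(d*m)` time intervals
it sits at the centre of the `k`-th subcube. (The polygonal line through the successive centres is
at distance `O(2^(-m))` and so has the same limit.) -/
def approx (Q : HilbertOrdering d) (m : ℕ) (t : I) : EuclideanSpace ℝ (Fin d) :=
  WithLp.toLp 2 fun i => ((Q.cell m (index d m t) i : ℝ) + 1 / 2) / 2 ^ m

/-- The Hilbert curve `H : [0,1] → [0,1]^d`, the limit of its approximations. -/
def curve (Q : HilbertOrdering d) (t : I) : EuclideanSpace ℝ (Fin d) :=
  limUnder atTop fun m => Q.approx m t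

end HilbertOrdering

/-! ### Existence of Hilbert orderings, and convergence of the approximations -/

/-- `v` with the bit number `i` flipped. -/
def flipBit {d : ℕ} (i : Fin d) (v : Fin d → Bool) : Fin d → Bool := Function.update v i (!v i)

/-- One step of the recursive construction in dimension `d`: `g r` is the `r`-th of the `2^d` halves
of a cube, entered at its corner `s r` and left at the neighbouring corner along the axis `a r`. -/
structure HilbertPattern (d : ℕ) [NeZero d] where
  g : ℕ → Fin d → Bool
  s : ℕ → Fin d → Bool
  a : ℕ → Fin d
  surj : ∀ v, ∃ r < 2 ^ d, g r = v
  g_zero : g 0 = fun _ => false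
  s_zero : s 0 = fun _ => false
  g_last : g (2 ^ d - 1) = flipBit 0 fun _ => false
  f_last : flipBit (a (2 ^ d - 1)) (s (2 ^ d - 1)) = flipBit 0 fun _ => false
  step : ∀ r, r + 1 < 2 ^ d → ∃ i, g (r + 1) = flipBit i (g r) ∧
    s (r + 1) = flipBit i (flipBit (a r) (s r)) ∧ flipBit (a r) (s r) i = g (r + 1) i

theorem flipBit_flipBit {d : ℕ} (i : Fin d) (v : Fin d → Bool) : flipBit i (flipBit i v) = v := by
  simp [flipBit]

theorem flipBit_cons_zero {d : ℕ} (b : Bool) (v : Fin d → Bool) :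
    flipBit 0 (Fin.cons b v : Fin (d + 1) → Bool) = Fin.cons (!b) v := by
  simp [flipBit, Fin.cons_zero, Fin.update_cons_zero]

theorem flipBit_cons_succ {d : ℕ} (i : Fin d) (b : Bool) (v : Fin d → Bool) :
    flipBit i.succ (Fin.cons b v : Fin (d + 1) → Bool) = Fin.cons b (flipBit i v) := by
  simp [flipBit, Fin.cons_succ, Fin.cons_update]

theorem cons_false {d : ℕ} :
    (Fin.cons false fun _ => false : Fin (d + 1) → Bool) = fun _ => false := by
  funext i
  refine Fin.cases ?_ (fun j => ?_) i <;> simp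

/-- The reflected-Gray-code pattern, by recursion on the dimension. -/
theorem HilbertPattern.nonempty (n : ℕ) : Nonempty (HilbertPattern (n + 1)) := by
  induction n with
  | zero =>
    refine ⟨⟨fun r _ => r == 1, fun _ _ => false, fun _ => 0, ?_, ?_, ?_, ?_, ?_, ?_⟩⟩
    · intro v
      cases hv : v 0
      · exact ⟨0, by norm_num, by funext i; rw [Fin.fin_one_eq_zero i, hv]; rfl⟩
      · exact ⟨1, by norm_num, by funext i; rw [Fin.fin_one_eq_zero i, hv]; rfl⟩
    · rfl
    · rfl
    · funext i; rw [Fin.fin_one_eq_zero i]; rfl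
    · funext i; rw [Fin.fin_one_eq_zero i]
    · intro r hr
      have : r = 0 := by simp at hr; omega
      subst this
      refine ⟨0, ?_, ?_, ?_⟩ <;> first | rfl | (funext i; rw [Fin.fin_one_eq_zero i]; rfl)
  | succ n ih =>
    obtain ⟨p⟩ := ih
    set K := 2 ^ (n + 1) with hK
    have hK2 : 2 ≤ K := by rw [hK, pow_succ]; have := Nat.one_le_two_pow (n := n); omega
    have hK' : 2 ^ (n + 1 + 1) = 2 * K := by rw [hK]; ring
    refine ⟨⟨fun r => if r < K then Fin.cons false (p.g r) else Fin.cons true (p.g (2 * K - 1 - r)),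
      fun r => if r < K then Fin.cons false (p.s r) else
        if r = K then Fin.cons false (p.s (K - 1)) else
          Fin.cons true (flipBit (p.a (2 * K - 1 - r)) (p.s (2 * K - 1 - r))),
      fun r => if r + 1 < K then (p.a r).succ else if r ≤ K then 0 else (p.a (2 * K - 1 - r)).succ,
      ?_, ?_, ?_, ?_, ?_, ?_⟩⟩
    · intro v
      obtain ⟨r, hr, hv⟩ := p.surj (Fin.tail v)
      rw [← hK] at hr
      rw [hK']
      cases h0 : v 0
      · refine ⟨r, by omega, ?_⟩
        simp only [hr, if_true]
        rw [hv, ← h0, Fin.cons_self_tail]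
      · refine ⟨2 * K - 1 - r, by omega, ?_⟩
        rw [if_neg (by omega), show 2 * K - 1 - (2 * K - 1 - r) = r by omega,
          hv, ← h0, Fin.cons_self_tail]
    · simp only [show 0 < K by omega, if_true, p.g_zero, cons_false]
    · simp only [show 0 < K by omega, if_true, p.s_zero, cons_false]
    · rw [hK']
      simp only [show ¬ 2 * K - 1 < K by omega, if_false, Nat.sub_self, p.g_zero]
      conv_rhs => rw [← cons_false, flipBit_cons_zero]
      rfl
    · rw [hK']
      simp only [show ¬ 2 * K - 1 < K by omega, show ¬ 2 * K - 1 = K by omega,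
        show ¬ 2 * K - 1 + 1 < K by omega, show ¬ 2 * K - 1 ≤ K by omega, if_false, Nat.sub_self]
      rw [flipBit_cons_succ, flipBit_flipBit, p.s_zero]
      conv_rhs => rw [← cons_false, flipBit_cons_zero]
      rfl
    · intro r hr
      rw [hK'] at hr
      rcases lt_trichotomy (r + 1) K with h | h | h
      · obtain ⟨i, h1, h2, h3⟩ := p.step r (by omega)
        refine ⟨i.succ, ?_⟩
        simp only [h, show r < K by omega, if_true]
        rw [flipBit_cons_succ, flipBit_cons_succ, flipBit_cons_succ, ← h1, ← h2]
        exact ⟨rfl, rfl, by simpa using h3⟩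
      · refine ⟨0, ?_⟩
        have hr' : r = K - 1 := by omega
        simp only [show r < K by omega, show r ≤ K by omega, h,
          if_true, if_false, lt_irrefl]
        rw [flipBit_cons_zero, flipBit_cons_zero, flipBit_cons_zero,
          show 2 * K - 1 - K = r by omega, hr']
        exact ⟨rfl, rfl, rfl⟩
      · obtain ⟨i, h1, h2, h3⟩ := p.step (2 * K - 1 - (r + 1)) (by omega)
        refine ⟨i.succ, ?_⟩
        rw [show 2 * K - 1 - (r + 1) + 1 = 2 * K - 1 - r by omega] at h1 h2 h3
        have hf : flipBit (if r + 1 < K then (p.a r).succ else if r ≤ K then 0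
              else (p.a (2 * K - 1 - r)).succ)
            (if r < K then Fin.cons false (p.s r) else
              if r = K then Fin.cons false (p.s (K - 1)) else
              Fin.cons true (flipBit (p.a (2 * K - 1 - r)) (p.s (2 * K - 1 - r))) :
                Fin (n + 1 + 1) → Bool)
            = Fin.cons true (p.s (2 * K - 1 - r)) := by
          by_cases hrK : r = K
          · simp only [hrK, show ¬ K + 1 < K by omega, lt_irrefl, le_refl, if_true, if_false]
            rw [flipBit_cons_zero, show 2 * K - 1 - K = K - 1 by omega]
            rfl
          · simp only [show ¬ r + 1 < K by omega, show ¬ r < K by omega, show ¬ r ≤ K by omega, hrK,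
              if_false]
            rw [flipBit_cons_succ, flipBit_flipBit]
        simp only [hf]
        simp only [show ¬ r + 1 < K by omega, show ¬ r < K by omega,
          show ¬ r + 1 = K by omega, if_false]
        rw [flipBit_cons_succ, flipBit_cons_succ, h1, h2, flipBit_flipBit, flipBit_flipBit]
        refine ⟨rfl, rfl, ?_⟩
        rw [h1] at h3
        simp only [Fin.cons_succ]
        rw [flipBit, Function.update_self, h3]
        simp [flipBit]

/-- The symmetry of the cube that permutes the axes by `T.1` and then reflects by `T.2`. -/
def signedPerm {d : ℕ} (T : Equiv.Perm (Fin d) × (Fin d → Bool)) (v : Fin d → Bool) :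
    Fin d → Bool :=
  fun i => xor (T.2 i) (v (T.1 i))

theorem signedPerm_flipBit {d : ℕ} (T : Equiv.Perm (Fin d) × (Fin d → Bool)) (i : Fin d)
    (v : Fin d → Bool) :
    signedPerm T (flipBit i v) = flipBit (T.1.symm i) (signedPerm T v) := by
  funext j
  by_cases h : j = T.1.symm i
  · subst h
    simp [signedPerm, flipBit]
  · have h' : T.1 j ≠ i := fun e => h (by simp [← e])
    simp [signedPerm, flipBit, Function.update_of_ne h, Function.update_of_ne h']

namespace HilbertPattern

variable {d : ℕ} [NeZero d]

/-- The symmetry that moves the standard pattern into the `r`-th half. -/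
def sym (p : HilbertPattern d) (r : ℕ) : Equiv.Perm (Fin d) × (Fin d → Bool) :=
  (Equiv.swap 0 (p.a r), p.s r)

/-- The `k`-th subcube of level `m`, and the symmetry applied to the pattern inside it. -/
def build (p : HilbertPattern d) : ℕ → ℕ → (Fin d → ℕ) × Equiv.Perm (Fin d) × (Fin d → Bool)
  | 0, _ => (0, 1, fun _ => false)
  | m + 1, k =>
    let q := p.build m (k / 2 ^ d)
    let r := k % 2 ^ d
    (fun i => 2 * q.1 i + (signedPerm q.2 (p.g r) i).toNat,
      q.2.1.trans (p.sym r).1, signedPerm q.2 (p.sym r).2)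

theorem sym_zero (p : HilbertPattern d) (r : ℕ) : signedPerm (p.sym r) (fun _ => false) = p.s r := by
  funext i
  simp [signedPerm, sym]

theorem sym_last (p : HilbertPattern d) (r : ℕ) :
    signedPerm (p.sym r) (flipBit 0 fun _ => false) = flipBit (p.a r) (p.s r) := by
  rw [signedPerm_flipBit, sym_zero]
  simp [sym]

theorem build_sym (p : HilbertPattern d) (m k : ℕ) (v : Fin d → Bool) :
    signedPerm (p.build (m + 1) k).2 v =
      signedPerm (p.build m (k / 2 ^ d)).2 (signedPerm (p.sym (k % 2 ^ d)) v) := by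
  funext i
  simp [signedPerm, build]

theorem build_lt (p : HilbertPattern d) (m k : ℕ) (i : Fin d) : (p.build m k).1 i < 2 ^ m := by
  induction m generalizing k with
  | zero => simp [build]
  | succ m ih =>
    have h1 := ih (k / 2 ^ d)
    have h2 := Bool.toNat_lt (signedPerm (p.build m (k / 2 ^ d)).2 (p.g (k % 2 ^ d)) i)
    simp only [build, pow_succ]
    omega

theorem build_surj (p : HilbertPattern d) (m : ℕ) (c : Fin d → ℕ) (hc : ∀ i, c i < 2 ^ m) :
    ∃ k < 2 ^ (d * m), (p.build m k).1 = c := by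
  induction m generalizing c with
  | zero => exact ⟨0, by simp, by funext i; have := hc i; simp at this; simp [build, this]⟩
  | succ m ih =>
    obtain ⟨q, hq, hqc⟩ := ih (fun i => c i / 2) (fun i => by
      have := hc i
      rw [pow_succ] at this
      omega)
    set T := (p.build m q).2 with hT
    obtain ⟨r, hr, hg⟩ := p.surj fun i => xor (T.2 (T.1.symm i)) (c (T.1.symm i) % 2 == 1)
    have hpos : 0 < 2 ^ d := by positivity
    have e1 : (2 ^ d * q + r) / 2 ^ d = q := by
      rw [Nat.mul_add_div hpos, Nat.div_eq_of_lt hr, add_zero]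
    have e2 : (2 ^ d * q + r) % 2 ^ d = r := by
      rw [Nat.mul_add_mod, Nat.mod_eq_of_lt hr]
    refine ⟨2 ^ d * q + r, ?_, ?_⟩
    · calc 2 ^ d * q + r < 2 ^ d * (q + 1) := by rw [mul_add]; omega
        _ ≤ 2 ^ d * 2 ^ (d * m) := Nat.mul_le_mul_left _ hq
        _ = 2 ^ (d * (m + 1)) := by rw [← pow_add]; congr 1; ring
    · funext i
      simp only [build, e1, e2, ← hT, hg, hqc, signedPerm]
      rcases Nat.mod_two_eq_zero_or_one (c i) with h | h <;> simp [h] <;> omega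

theorem build_adj (p : HilbertPattern d) (m k : ℕ) (hk : k + 1 < 2 ^ (d * m)) : ∃ i,
    (∀ j, j ≠ i → (p.build m (k + 1)).1 j = (p.build m k).1 j ∧
      signedPerm (p.build m (k + 1)).2 (fun _ => false) j =
        signedPerm (p.build m k).2 (flipBit 0 fun _ => false) j) ∧
    (((p.build m (k + 1)).1 i = (p.build m k).1 i + 1 ∧
        signedPerm (p.build m (k + 1)).2 (fun _ => false) i = false ∧
        signedPerm (p.build m k).2 (flipBit 0 fun _ => false) i = true) ∨
      ((p.build m k).1 i = (p.build m (k + 1)).1 i + 1 ∧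
        signedPerm (p.build m (k + 1)).2 (fun _ => false) i = true ∧
        signedPerm (p.build m k).2 (flipBit 0 fun _ => false) i = false)) := by
  induction m generalizing k with
  | zero => simp at hk
  | succ m ih =>
    have hpos : 0 < 2 ^ d := by positivity
    have hdm : k / 2 ^ d * 2 ^ d + k % 2 ^ d = k := Nat.div_add_mod' k _
    have hlt := Nat.mod_lt k hpos
    rw [build_sym, build_sym, sym_zero, sym_last]
    by_cases hr : k % 2 ^ d + 1 < 2 ^ d
    · have e : k + 1 = 2 ^ d * (k / 2 ^ d) + (k % 2 ^ d + 1) := by rw [mul_comm]; omega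
      have e1 : (k + 1) / 2 ^ d = k / 2 ^ d := by
        rw [e, Nat.mul_add_div hpos, Nat.div_eq_of_lt hr, add_zero]
      have e2 : (k + 1) % 2 ^ d = k % 2 ^ d + 1 := by
        rw [e, Nat.mul_add_mod, Nat.mod_eq_of_lt hr]
      obtain ⟨i, h1, h2, h3⟩ := p.step _ hr
      simp only [build, e1, e2]
      set T := (p.build m (k / 2 ^ d)).2
      set f := flipBit (p.a (k % 2 ^ d)) (p.s (k % 2 ^ d))
      rw [h1] at h3
      rw [h1, h2, signedPerm_flipBit, signedPerm_flipBit]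
      refine ⟨T.1.symm i, fun j hj => ?_, ?_⟩
      · simp [flipBit, Function.update_of_ne hj]
      · have h4 : signedPerm T f (T.1.symm i) = !(signedPerm T (p.g (k % 2 ^ d)) (T.1.symm i)) := by
          simp [signedPerm, h3, flipBit]
        cases h5 : signedPerm T (p.g (k % 2 ^ d)) (T.1.symm i) <;> simp [flipBit, h4, h5]
    · have hr' : k % 2 ^ d = 2 ^ d - 1 := by omega
      have e : k + 1 = 2 ^ d * (k / 2 ^ d + 1) + 0 := by rw [mul_comm, add_mul]; omega
      have e1 : (k + 1) / 2 ^ d = k / 2 ^ d + 1 := by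
        rw [e, Nat.mul_add_div hpos, Nat.zero_div, add_zero]
      have e2 : (k + 1) % 2 ^ d = 0 := by
        rw [e, Nat.mul_add_mod, Nat.zero_mod]
      have hk' : k / 2 ^ d + 1 < 2 ^ (d * m) := by
        rw [← e1]
        refine Nat.div_lt_of_lt_mul ?_
        rw [← pow_add]
        convert hk using 2
        ring
      obtain ⟨i, h1, h2⟩ := ih _ hk'
      simp only [build, e1, e2, hr', p.g_zero, p.s_zero, p.g_last, p.f_last]
      refine ⟨i, fun j hj => ?_, ?_⟩
      · rw [(h1 j hj).1, (h1 j hj).2]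
        exact ⟨rfl, rfl⟩
      · rcases h2 with ⟨ha, hb, hc⟩ | ⟨ha, hb, hc⟩
        · left
          simp only [ha, hb, hc]
          simp
          omega
        · right
          simp only [ha, hb, hc]
          simp
          omega

theorem build_zero (p : HilbertPattern d) (m : ℕ) :
    (p.build m 0).1 = 0 ∧ signedPerm (p.build m 0).2 (fun _ => false) = fun _ => false := by
  induction m with
  | zero => exact ⟨rfl, by funext i; simp [signedPerm, build]⟩
  | succ m ih =>
    refine ⟨?_, ?_⟩
    · funext i
      simp [build, ih.1, p.g_zero, ih.2]
    · rw [build_sym, Nat.zero_div, Nat.zero_mod, sym_zero, p.s_zero, ih.2]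

/-- The ordering obtained by iterating a pattern. -/
def ordering (p : HilbertPattern d) : HilbertOrdering d where
  cell m k := (p.build m k).1
  bijOn m := by
    have hs : Set.SurjOn (fun k => (p.build m k).1) (Finset.range (2 ^ (d * m)) : Set ℕ)
        (Fintype.piFinset fun _ : Fin d => Finset.range (2 ^ m) : Set (Fin d → ℕ)) := by
      intro c hc
      obtain ⟨k, hk, h⟩ := p.build_surj m c (by simpa using hc)
      exact ⟨k, by simpa using hk, h⟩
    have hi := Finset.injOn_of_surjOn_of_card_le (fun k => (p.build m k).1)
      (fun k _ => by simpa using p.build_lt m k) hs (by simp [← pow_mul, mul_comm])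
    refine ⟨fun k _ i => p.build_lt m k i, by simpa [Set.Iio_def] using hi, ?_⟩
    intro c hc
    obtain ⟨k, hk, h⟩ := p.build_surj m c hc
    exact ⟨k, hk, h⟩
  nested m k _ i := by
    have h2 := Bool.toNat_lt (signedPerm (p.build m (k / 2 ^ d)).2 (p.g (k % 2 ^ d)) i)
    simp only [build]
    omega
  adjacent m k hk := by
    obtain ⟨i, h1, h2⟩ := p.build_adj m k hk
    exact ⟨i, h2.imp And.left And.left, fun j hj => (h1 j hj).1⟩
  start m := (p.build_zero m).1

end HilbertPattern

/-- Hilbert orderings exist in every dimension. -/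
theorem HilbertOrdering.nonempty (d : ℕ) (hd : 1 ≤ d) : Nonempty (HilbertOrdering d) := by
  obtain ⟨n, rfl⟩ : ∃ n, d = n + 1 := ⟨d - 1, by omega⟩
  exact (HilbertPattern.nonempty n).map HilbertPattern.ordering

namespace HilbertOrdering

variable {d : ℕ}

theorem index_lt (d m : ℕ) (t : I) : index d m t < 2 ^ (d * m) := by
  have : 0 < 2 ^ (d * m) := by positivity
  unfold index
  omega

theorem index_succ (d m : ℕ) (t : I) : index d (m + 1) t / 2 ^ d = index d m t := by
  have hpos : 0 < 2 ^ d := by positivity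
  have hK : 0 < 2 ^ (d * m) := by positivity
  have e : 2 ^ (d * (m + 1)) = 2 ^ d * 2 ^ (d * m) := by rw [← pow_add]; congr 1; ring
  have h1 : ⌊(t : ℝ) * 2 ^ (d * (m + 1))⌋₊ / 2 ^ d = ⌊(t : ℝ) * 2 ^ (d * m)⌋₊ := by
    rw [← Nat.floor_div_natCast]
    congr 1
    push_cast
    rw [show d * (m + 1) = d * m + d by ring, pow_add, ← mul_assoc]
    field_simp
  have h2 : (2 ^ (d * (m + 1)) - 1) / 2 ^ d = 2 ^ (d * m) - 1 := by
    rw [e]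
    have : 2 ^ d * 2 ^ (d * m) - 1 = 2 ^ d * (2 ^ (d * m) - 1) + (2 ^ d - 1) := by
      rw [Nat.mul_sub, mul_one]
      have := Nat.le_mul_of_pos_right (2 ^ d) hK
      omega
    rw [this, Nat.mul_add_div hpos, Nat.div_eq_of_lt (by omega), add_zero]
  unfold index
  rw [← h1, ← h2]
  exact Monotone.map_min (f := fun a : ℕ => a / 2 ^ d) fun a b h => Nat.div_le_div_right h

/-- The approximations of the Hilbert curve converge, so that `curve` is their genuine limit. -/
theorem tendsto_approx (Q : HilbertOrdering d) (t : I) :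
    Tendsto (fun m => Q.approx m t) atTop (𝓝 (Q.curve t)) := by
  have hpi : CauchySeq fun m i => Q.approx m t i := by
    refine cauchySeq_of_le_geometric_two (C := 1) fun m => ?_
    refine (dist_pi_le_iff (by positivity)).2 fun i => ?_
    have hn := Q.nested m (index d (m + 1) t) (index_lt d (m + 1) t) i
    rw [index_succ] at hn
    have hc : Q.cell (m + 1) (index d (m + 1) t) i = 2 * Q.cell m (index d m t) i ∨
        Q.cell (m + 1) (index d (m + 1) t) i = 2 * Q.cell m (index d m t) i + 1 := by omega
    have h2 : (0 : ℝ) < 2 ^ m := by positivity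
    simp only [approx, Real.dist_eq, pow_succ]
    rcases hc with h | h <;> rw [h] <;> push_cast
    · rw [show ((Q.cell m (index d m t) i : ℝ) + 1 / 2) / 2 ^ m -
        (2 * (Q.cell m (index d m t) i : ℝ) + 1 / 2) / (2 ^ m * 2) = 1 / 4 / 2 ^ m by
          field_simp; ring, abs_of_pos (by positivity)]
      gcongr
      norm_num
    · rw [show ((Q.cell m (index d m t) i : ℝ) + 1 / 2) / 2 ^ m -
        (2 * (Q.cell m (index d m t) i : ℝ) + 1 + 1 / 2) / (2 ^ m * 2) = -(1 / 4 / 2 ^ m) by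
          field_simp; ring, abs_neg, abs_of_pos (by positivity)]
      gcongr
      norm_num
  obtain ⟨y, hy⟩ := cauchySeq_tendsto_of_complete hpi
  exact tendsto_nhds_limUnder
    ⟨WithLp.toLp 2 y, ((PiLp.continuous_toLp 2 _).tendsto y).comp hy⟩

end HilbertOrdering

/-- A one-to-one Borel measurable pseudo-inverse `h : [0,1]^d → [0,1]` of a curve `H`. -/
structure IsPseudoInverse {d : ℕ} (H : I → EuclideanSpace ℝ (Fin d)) (h : closedCube d → I) :
    Prop where
  measurable : Measurable h
  injective : Function.Injective h
  right_inv : ∀ x, H (h x) = x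

/-! ## Cubifiable sets -/

/-- A cubifiable set `X ⊆ ℝ^d` together with a map `ψ` of the admitted class `𝒟(X)`: `X` is a
product of measurable sets `X_i ⊆ ℝ`, and `ψ_i : X_i → (0,1)` is a strictly increasing bijection
with continuously differentiable inverse. -/
structure Cubification {d : ℕ} (X : Set (EuclideanSpace ℝ (Fin d))) where
  side : Fin d → Set ℝ
  measurableSet_side : ∀ i, MeasurableSet (side i)
  eq_prod : X = {x | ∀ i, x i ∈ side i}
  coord : ∀ i, side i ≃o Set.Ioo (0 : ℝ) 1
  /-- `ψ_i⁻¹`, extended by `0` to a function on `ℝ`, is `C^1` on `(0,1)`. -/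
  contDiffOn_symm : ∀ i, ContDiffOn ℝ 1
    (Function.extend Subtype.val (fun t => ((coord i).symm t : ℝ)) 0) (Set.Ioo (0 : ℝ) 1)

namespace Cubification

variable {d : ℕ} {X : Set (EuclideanSpace ℝ (Fin d))}

theorem mem_side (D : Cubification X) (x : X) (i : Fin d) : x.1 i ∈ D.side i := by
  have h : x.1 ∈ {x : EuclideanSpace ℝ (Fin d) | ∀ i, x i ∈ D.side i} := D.eq_prod ▸ x.2
  exact h i

/-- The bijection `ψ(x) = (ψ_1(x_1), ..., ψ_d(x_d))` from `X` onto `(0,1)^d`. -/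
def psi (D : Cubification X) : X ≃ openCube d where
  toFun x := ⟨WithLp.toLp 2 fun i => (D.coord i ⟨x.1 i, D.mem_side x i⟩ : ℝ),
    fun i => (D.coord i ⟨x.1 i, D.mem_side x i⟩).2⟩
  invFun y := ⟨WithLp.toLp 2 fun i => ((D.coord i).symm ⟨y.1 i, y.2 i⟩ : ℝ), by
    have h : (WithLp.toLp 2 fun i => ((D.coord i).symm ⟨y.1 i, y.2 i⟩ : ℝ)) ∈
      {x : EuclideanSpace ℝ (Fin d) | ∀ i, x i ∈ D.side i} :=
        fun i => ((D.coord i).symm ⟨y.1 i, y.2 i⟩).2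
    exact D.eq_prod.ge h⟩
  left_inv x := by
    ext i
    simp
  right_inv y := by
    ext i
    simp

/-- `h_X = h ∘ ψ`. -/
def order (D : Cubification X) (h : closedCube d → I) (x : X) : I :=
  h (Set.inclusion (openCube_subset_closedCube d) (D.psi x))

end Cubification

/-! ## Stratified resampling -/

/-- The set `𝒵^N` of weighted point sets `(x^n, w^n)`, `n = 1, ..., N`, in `X`. -/
structure WeightedSample (X : Type*) (N : ℕ) where
  pos : Fin N → X
  weight : Fin N → ℝ
  weight_nonneg : ∀ n, 0 ≤ weight n
  sum_weight : ∑ n, weight n = 1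

namespace WeightedSample

variable {X : Type*} {N : ℕ}

/-- The relabelled point set `(z_{τ(n)})_n`. -/
def permute (z : WeightedSample X N) (τ : Equiv.Perm (Fin N)) : WeightedSample X N where
  pos n := z.pos (τ n)
  weight n := z.weight (τ n)
  weight_nonneg n := z.weight_nonneg (τ n)
  sum_weight := by rw [Equiv.sum_comp τ z.weight, z.sum_weight]

/-- The distribution function `F_N(n) = w^1 + ... + w^n` on the indices. -/
def cdf (z : WeightedSample X N) (n : Fin N) : ℝ := ∑ m ∈ Finset.Iic n, z.weight m

/-- The generalized inverse `F_N^-(u)`, the least index `n` with `u ≤ F_N(n)` (such an index exists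
whenever `u ≤ 1`). -/
def invCdf [NeZero N] (z : WeightedSample X N) (u : ℝ) : Fin N := sInf {n | u ≤ z.cdf n}

/-- The stratified resampling indices `a_N^n(u, z) = F_N^-((n - 1 + u_n) / N)`; here the indices `n`
and the entries of `u` are numbered from `0`. -/
def stratIndex [NeZero N] (u : ℕ → I) (z : WeightedSample X N) (n : Fin N) : Fin N :=
  z.invCdf (((n : ℝ) + (u n : ℝ)) / N)

/-- Stratified resampling `ρ_strat(u, z)`, the measure `N⁻¹ ∑ n, δ(x^{a_N^n(u, z)})`. -/
def strat [MeasurableSpace X] [NeZero N] (u : ℕ → I) (z : WeightedSample X N) : Measure X :=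
  (N : ℝ≥0∞)⁻¹ • ∑ n, Measure.dirac (z.pos (z.stratIndex u n))

/-- Ordered stratified resampling `ρ*_strat(u, z) = ρ_strat(u, (z_{τ(n)})_n)`, for an ordering
permutation `τ` of the points of `z`. -/
def orderedStrat [MeasurableSpace X] [NeZero N] (u : ℕ → I) (z : WeightedSample X N)
    (τ : Equiv.Perm (Fin N)) : Measure X :=
  (z.permute τ).strat u

end WeightedSample

end

/-! Along the Hilbert order the problem becomes one-dimensional. The curve `H` is Hölder with
exponent `1/d` and constant `K = 2√(d+3)` (`norm_curve_sub_le`), and `H ∘ h = id`. Hence the values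
of `φ` at two sample points differ by at most `|C| K^γ Δ^(γ/d)`, where `Δ` is the gap between their
times under `h ∘ ψ`; no continuity of `h` is needed.

As `F^-` is monotone, the point drawn in stratum `[n/N, (n+1)/N]` lies, in Hilbert time, between the
points selected at the two ends of the stratum, whatever the draw. Let `ℓ_n` be the length of that
time interval. The drawn values are independent, so the variance of their average is `N⁻²` times the
sum of their variances, and each of these is at most `C² K^(2γ) ℓ_n^(2γ/d)`
(`variance_integral_strat_le`).

Since `ℓ_n ≤ 1`, the exponent may be lowered to `γ/d ≤ 1`. The lengths telescope to a total of at
most 1, so concavity (`sum_rpow_le_card_rpow`) gives `∑ ℓ_n^(γ/d) ≤ N^(1-γ/d)`, and the factor `N⁻²`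
turns this into the stated rate. -/

/-! ### Hölder continuity of the Hilbert curve -/

namespace HilbertOrdering

variable {d : ℕ}

/-- The subcubes visited at time `t` at the levels `m` and `m + j` are nested. -/
theorem cell_index_add (Q : HilbertOrdering d) (t : I) (m j : ℕ) (i : Fin d) :
    Q.cell m (index d m t) i * 2 ^ j ≤ Q.cell (m + j) (index d (m + j) t) i ∧
      Q.cell (m + j) (index d (m + j) t) i + 1 ≤ (Q.cell m (index d m t) i + 1) * 2 ^ j := by
  induction j with
  | zero => simp
  | succ j ih =>
    have hn := Q.nested (m + j) (index d (m + j + 1) t) (index_lt d _ t) i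
    rw [index_succ] at hn
    -- A half of the subcube with coordinate `a` has coordinate `2a` or `2a + 1`, so both bounds
    -- double at each level.
    rw [← add_assoc, pow_succ, ← mul_assoc, ← mul_assoc]
    omega

/-- At time `t` the curve lies in the subcube of level `m` visited at that time. -/
theorem curve_mem_cell (Q : HilbertOrdering d) (t : I) (m : ℕ) (i : Fin d) :
    Q.curve t i ∈ Set.Icc ((Q.cell m (index d m t) i : ℝ) / 2 ^ m)
      (((Q.cell m (index d m t) i : ℝ) + 1) / 2 ^ m) := by
  have hlim : Tendsto (fun j => Q.approx (m + j) t i) atTop (𝓝 (Q.curve t i)) :=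
    (((EuclideanSpace.proj (𝕜 := ℝ) i).continuous.tendsto _).comp (Q.tendsto_approx t)).comp
      (tendsto_atTop_mono (Nat.le_add_left · m) tendsto_id)
  -- From level `m` on the approximations sit at centres inside this closed subcube, which therefore
  -- contains their limit.
  refine isClosed_Icc.mem_of_tendsto hlim (Eventually.of_forall fun j => ?_)
  obtain ⟨h1, h2⟩ := Q.cell_index_add t m j i
  have h1' : (Q.cell m (index d m t) i : ℝ) * 2 ^ j ≤ Q.cell (m + j) (index d (m + j) t) i := by
    exact_mod_cast h1
  have h2' : (Q.cell (m + j) (index d (m + j) t) i : ℝ) + 1 ≤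
      ((Q.cell m (index d m t) i : ℝ) + 1) * 2 ^ j := by
    exact_mod_cast h2
  simp only [approx, pow_add]
  constructor
  · rw [div_le_div_iff₀ (by positivity) (by positivity)]
    have : (0 : ℝ) < 2 ^ m := by positivity
    nlinarith
  · rw [div_le_div_iff₀ (by positivity) (by positivity)]
    have : (0 : ℝ) < 2 ^ m := by positivity
    nlinarith

theorem index_mono (d m : ℕ) {s t : I} (h : s ≤ t) : index d m s ≤ index d m t := by
  have : (s : ℝ) ≤ t := h
  unfold index
  gcongr

/-- Times at distance at most `2^(-d*m)` belong to equal or successive intervals of level `m`. -/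
theorem index_le_index_add_one (d m : ℕ) {s t : I} (h : (t : ℝ) - s ≤ (2 ^ (d * m))⁻¹) :
    index d m t ≤ index d m s + 1 := by
  have hK : (0 : ℝ) < 2 ^ (d * m) := by positivity
  have h1 : (t : ℝ) * 2 ^ (d * m) ≤ s * 2 ^ (d * m) + 1 := by
    have := mul_le_mul_of_nonneg_right h hK.le
    rw [inv_mul_cancel₀ hK.ne'] at this
    linarith
  have h2 : ⌊(t : ℝ) * 2 ^ (d * m)⌋₊ ≤ ⌊(s : ℝ) * 2 ^ (d * m)⌋₊ + 1 := by
    rw [← Nat.floor_add_one (mul_nonneg s.2.1 hK.le)]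
    exact Nat.floor_le_floor h1
  -- The cap at `2^(d*m) - 1`, which assigns `t = 1` to the last interval, preserves the inequality.
  unfold index
  omega

/-- Two points of the same or of two successive subcubes of level `m` are at distance at most
`√(d+3) * 2^(-m)`. -/
theorem norm_curve_sub_le_of_index_le (Q : HilbertOrdering d) (hd : 1 ≤ d) (m : ℕ) {s t : I}
    (hst : s ≤ t) (h : index d m t ≤ index d m s + 1) :
    ‖Q.curve t - Q.curve s‖ ≤ √((d : ℝ) + 3) / 2 ^ m := by
  have hK : (0 : ℝ) < 2 ^ m := by positivity
  -- Only along the axis of the shared face can the points differ by two side lengths; along the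
  -- other `d - 1` axes they differ by at most one. The squares add up to `4 + (d - 1) = d + 3`.
  obtain ⟨i₀, hi₀, hne⟩ : ∃ i₀ : Fin d, |Q.curve t i₀ - Q.curve s i₀| ≤ 2 / 2 ^ m ∧
      ∀ j, j ≠ i₀ → |Q.curve t j - Q.curve s j| ≤ 1 / 2 ^ m := by
    have hle : ∀ j, Q.cell m (index d m t) j = Q.cell m (index d m s) j →
        |Q.curve t j - Q.curve s j| ≤ 1 / 2 ^ m := by
      intro j hj
      obtain ⟨a, b⟩ := Q.curve_mem_cell s m j
      obtain ⟨a', b'⟩ := Q.curve_mem_cell t m j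
      rw [hj, add_div] at b'
      rw [hj] at a'
      rw [add_div] at b
      rw [abs_le]
      constructor <;> linarith
    rcases (index_mono d m hst).eq_or_lt with he | hlt
    · refine ⟨⟨0, hd⟩, (hle _ (by rw [he])).trans (by gcongr; norm_num), fun j _ => hle j (by rw [he])⟩
    · have he : index d m t = index d m s + 1 := by omega
      obtain ⟨i, hi, hj⟩ := Q.adjacent m (index d m s) (he ▸ index_lt d m t)
      rw [← he] at hi hj
      refine ⟨i, ?_, fun j hji => hle j (hj j hji)⟩
      obtain ⟨a, b⟩ := Q.curve_mem_cell s m i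
      obtain ⟨a', b'⟩ := Q.curve_mem_cell t m i
      rw [add_div] at b b'
      rw [abs_le, show (2 : ℝ) / 2 ^ m = 1 / 2 ^ m + 1 / 2 ^ m by ring]
      have hm : (0 : ℝ) < 1 / 2 ^ m := by positivity
      rcases hi with hi | hi
      · rw [hi, Nat.cast_add_one, add_div] at a' b'
        constructor <;> linarith
      · rw [hi, Nat.cast_add_one, add_div] at a b
        constructor <;> linarith
  rw [EuclideanSpace.norm_eq, ← Real.sqrt_sq hK.le, ← Real.sqrt_div' _ (sq_nonneg _)]
  refine Real.sqrt_le_sqrt ?_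
  rw [← Finset.add_sum_erase _ _ (Finset.mem_univ i₀)]
  have h1 : ‖(Q.curve t - Q.curve s) i₀‖ ^ 2 ≤ 4 / (2 ^ m) ^ 2 := by
    calc ‖(Q.curve t - Q.curve s) i₀‖ ^ 2 ≤ (2 / 2 ^ m) ^ 2 := by
          gcongr
          simpa using hi₀
      _ = 4 / (2 ^ m) ^ 2 := by rw [div_pow]; norm_num
  have h2 : ∑ j ∈ Finset.univ.erase i₀, ‖(Q.curve t - Q.curve s) j‖ ^ 2 ≤
      ((d : ℝ) - 1) * (1 / (2 ^ m) ^ 2) := by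
    calc _ ≤ ∑ j ∈ Finset.univ.erase i₀, (1 / (2 ^ m) ^ 2 : ℝ) := by
          refine Finset.sum_le_sum fun j hj => ?_
          calc ‖(Q.curve t - Q.curve s) j‖ ^ 2 ≤ (1 / 2 ^ m) ^ 2 := by
                gcongr
                simpa using hne j (Finset.ne_of_mem_erase hj)
            _ = 1 / (2 ^ m) ^ 2 := by rw [div_pow, one_pow]
      _ = _ := by
          rw [Finset.sum_const, Finset.card_erase_of_mem (Finset.mem_univ _), Finset.card_univ,
            Fintype.card_fin, nsmul_eq_mul, Nat.cast_sub hd, Nat.cast_one]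
  calc _ ≤ 4 / (2 ^ m) ^ 2 + ((d : ℝ) - 1) * (1 / (2 ^ m) ^ 2) := add_le_add h1 h2
    _ = ((d : ℝ) + 3) / (2 ^ m) ^ 2 := by ring

/-- The Hilbert curve is Hölder continuous with exponent `1/d` and constant `2√(d+3)`. -/
theorem norm_curve_sub_le (Q : HilbertOrdering d) (hd : 1 ≤ d) {s t : I} (hst : s ≤ t) :
    ‖Q.curve t - Q.curve s‖ ≤ 2 * √((d : ℝ) + 3) * ((t : ℝ) - s) ^ (1 / d : ℝ) := by
  have hd0 : (d : ℝ) ≠ 0 := by positivity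
  rcases hst.eq_or_lt with rfl | hlt
  · simp [Real.zero_rpow, hd0]
  have hpos : 0 < (t : ℝ) - s := sub_pos.2 hlt
  -- The level with `2^(-d(m+1)) < t - s ≤ 2^(-dm)`. The upper bound makes the subcubes equal or
  -- successive; the lower one gives `2^(-m) ≤ 2 (t - s)^(1/d)`, the source of the factor 2.
  obtain ⟨m, h1, h2⟩ := exists_nat_pow_near_of_lt_one hpos
    (by linarith [t.2.2, s.2.1] : (t : ℝ) - s ≤ 1) (y := ((2 : ℝ) ^ d)⁻¹) (by positivity)
    (inv_lt_one_of_one_lt₀ (one_lt_pow₀ one_lt_two (by omega)))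
  have h3 : (2 : ℝ)⁻¹ ^ (m + 1) ≤ ((t : ℝ) - s) ^ (1 / d : ℝ) := by
    calc (2 : ℝ)⁻¹ ^ (m + 1) = (((2 : ℝ)⁻¹ ^ (m + 1)) ^ d) ^ (1 / d : ℝ) := by
          rw [one_div, Real.pow_rpow_inv_natCast (by positivity) (by omega)]
      _ = ((((2 : ℝ) ^ d)⁻¹) ^ (m + 1)) ^ (1 / d : ℝ) := by
          rw [← inv_pow, ← pow_mul, ← pow_mul, mul_comm]
      _ ≤ _ := by gcongr
  calc _ ≤ √((d : ℝ) + 3) / 2 ^ m := Q.norm_curve_sub_le_of_index_le hd m hst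
        (index_le_index_add_one d m (by rwa [pow_mul, ← inv_pow]))
    _ = 2 * √((d : ℝ) + 3) * (2 : ℝ)⁻¹ ^ (m + 1) := by
        rw [inv_pow, pow_succ]; field_simp
    _ ≤ _ := by gcongr

end HilbertOrdering

/-! ### The generalized inverse and the selected indices -/

namespace WeightedSample

variable {X : Type*} {N : ℕ}

theorem stratum_le_one {n : ℕ} (hn : n < N) {u : ℝ} (hu : u ≤ 1) : ((n : ℝ) + u) / N ≤ 1 := by
  have : (n : ℝ) + 1 ≤ N := by exact_mod_cast hn
  rw [div_le_one (by linarith [n.cast_nonneg (α := ℝ)])]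
  linarith

variable [NeZero N]

/-- The total weight is 1, so for `u ≤ 1` the last index qualifies; the set is nonempty and attains
its infimum. -/
theorem le_cdf_invCdf (z : WeightedSample X N) {u : ℝ} (hu : u ≤ 1) : u ≤ z.cdf (z.invCdf u) := by
  have hne : {n | u ≤ z.cdf n}.Nonempty := by
    refine ⟨⊤, ?_⟩
    simpa [cdf, z.sum_weight] using hu
  exact csInf_mem hne

/-- The index selected for `v` also qualifies for any smaller `u`. This monotonicity keeps each draw
between the ends of its stratum. -/
theorem invCdf_le_invCdf (z : WeightedSample X N) {u v : ℝ} (huv : u ≤ v) (hv : v ≤ 1) :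
    z.invCdf u ≤ z.invCdf v :=
  csInf_le (OrderBot.bddBelow _) (huv.trans (z.le_cdf_invCdf hv))

theorem measurable_invCdf_stratum (z : WeightedSample X N) (n : Fin N) :
    Measurable fun u : I => z.invCdf (((n : ℝ) + (u : ℝ)) / N) := by
  have hmono : Monotone fun u : I => z.invCdf (((n : ℝ) + (u : ℝ)) / N) := by
    intro u v huv
    refine z.invCdf_le_invCdf ?_ (stratum_le_one n.2 v.2.2)
    have : (u : ℝ) ≤ v := huv
    gcongr
  exact hmono.measurable

theorem integral_strat [MeasurableSpace X] (z : WeightedSample X N) (u : ℕ → I) {φ : X → ℝ}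
    (hφ : Measurable φ) :
    ∫ x, φ x ∂(z.strat u) = (N : ℝ)⁻¹ * ∑ n, φ (z.pos (z.stratIndex u n)) := by
  rw [strat, integral_smul_measure, integral_finsetSum_measure]
  · simp [integral_dirac' _ _ hφ.stronglyMeasurable]
  · intro n _
    exact integrable_dirac' hφ.stronglyMeasurable (by simp)

end WeightedSample

/-! ### Concavity and variance bounds -/

/-- Jensen's inequality for `x ↦ x ^ p` with `p ≤ 1`, for nonnegative numbers of total at most 1. -/
theorem sum_rpow_le_card_rpow {N : ℕ} [NeZero N] {ℓ : Fin N → ℝ} (h0 : ∀ n, 0 ≤ ℓ n)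
    (h1 : ∑ n, ℓ n ≤ 1) {p : ℝ} (hp0 : 0 ≤ p) (hp1 : p ≤ 1) :
    ∑ n, ℓ n ^ p ≤ (N : ℝ) ^ (1 - p) := by
  have hN : (0 : ℝ) < N := by exact_mod_cast Nat.pos_of_ne_zero (NeZero.ne N)
  -- With uniform weights `1/N`, the mean of the powers is at most the power of the mean, hence at
  -- most `N^(-p)`; multiplying by `N` gives the claim.
  have hJ := (Real.concaveOn_rpow hp0 hp1).le_map_sum (t := Finset.univ)
    (w := fun _ : Fin N => (N : ℝ)⁻¹) (p := ℓ) (fun _ _ => by positivity) (by simp [hN.ne']) (fun n _ => h0 n)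
  simp only [smul_eq_mul, ← Finset.mul_sum] at hJ
  have h2 : ((N : ℝ)⁻¹ * ∑ n, ℓ n) ^ p ≤ ((N : ℝ)⁻¹) ^ p := by
    have := Finset.sum_nonneg fun n (_ : n ∈ Finset.univ) => h0 n
    gcongr
    exact mul_le_of_le_one_right (by positivity) h1
  have h3 := hJ.trans h2
  rw [inv_mul_le_iff₀ hN, Real.inv_rpow hN.le] at h3
  rwa [Real.rpow_sub hN, Real.rpow_one, div_eq_mul_inv]

/-- A random variable within distance `r` of a constant has variance at most `r²`. -/
theorem variance_le_sq_of_abs_sub_le {Ω : Type*} [MeasurableSpace Ω] {P : Measure Ω}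
    [IsProbabilityMeasure P] {Y : Ω → ℝ} (hY : Measurable Y) {c r : ℝ}
    (h : ∀ ω, |Y ω - c| ≤ r) : Var[Y; P] ≤ r ^ 2 := by
  -- Popoviciu's bound is the square of half the width of the interval, here exactly `r²`.
  refine (variance_le_sq_of_bounded (a := c - r) (b := c + r)
    (Eventually.of_forall fun ω => ?_) hY.aemeasurable).trans (le_of_eq (by ring))
  have := abs_le.1 (h ω)
  constructor <;> linarith

/-- The variance of the average of a function of the points selected by stratified resampling, when
the selected values in stratum `n` are within `r n` of a constant. -/
theorem WeightedSample.variance_integral_strat_le {X : Type*} [MeasurableSpace X] {N : ℕ} [NeZero N]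
    (z : WeightedSample X N) {φ : X → ℝ} (hφ : Measurable φ)
    {Ω : Type*} [MeasurableSpace Ω] (P : Measure Ω) [IsProbabilityMeasure P]
    {U : ℕ → Ω → I} (hU_meas : ∀ n, Measurable (U n)) (hU_indep : iIndepFun U P)
    {c r : Fin N → ℝ}
    (hr : ∀ u n, |φ (z.pos (z.stratIndex u n)) - c n| ≤ r n) :
    MemLp (fun ω => ∫ x, φ x ∂(z.strat fun n => U n ω)) 2 P ∧
    Var[fun ω => ∫ x, φ x ∂(z.strat fun n => U n ω); P] ≤ ((N : ℝ)⁻¹) ^ 2 * ∑ n, r n ^ 2 := by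
  let g : Fin N → I → ℝ := fun n u => φ (z.pos (z.invCdf (((n : ℝ) + (u : ℝ)) / N)))
  have hg : ∀ n, Measurable (g n) := fun n =>
    (Measurable.of_discrete (f := fun k => φ (z.pos k))).comp (z.measurable_invCdf_stratum n)
  let Y : Fin N → Ω → ℝ := fun n => g n ∘ U n
  have hYm : ∀ n, Measurable (Y n) := fun n => (hg n).comp (hU_meas n)
  have hYr : ∀ n ω, |Y n ω - c n| ≤ r n := fun n ω => hr (fun k => U k ω) n
  have hYL : ∀ n, MemLp (Y n) 2 P := fun n => by
    refine memLp_of_bounded (a := c n - r n) (b := c n + r n) (Eventually.of_forall fun ω => ?_)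
      (hYm n).aestronglyMeasurable 2
    have := abs_le.1 (hYr n ω)
    constructor <;> linarith
  -- The value drawn in stratum `n` depends on `U n` alone.
  have hind : iIndepFun Y P :=
    (hU_indep.precomp (g := fun n : Fin N => (n : ℕ)) Fin.val_injective).comp g hg
  have heq : (fun ω => ∫ x, φ x ∂(z.strat fun n => U n ω)) =
      fun ω => (N : ℝ)⁻¹ * (∑ n, Y n) ω := by
    funext ω
    rw [z.integral_strat _ hφ, Finset.sum_apply]
    rfl
  rw [heq]
  refine ⟨(memLp_finsetSum' _ fun n _ => hYL n).const_mul _, ?_⟩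
  rw [variance_const_mul, IndepFun.variance_sum (fun n _ => hYL n)
    fun i _ j _ hij => hind.indepFun hij]
  gcongr with n
  exact variance_le_sq_of_abs_sub_le (hYm n) (hYr n)

/-! ### The variance bound -/

theorem mainTheorem7 {d : ℕ} (hd : 1 ≤ d)
    (Q : HilbertOrdering d)
    (h : closedCube d → I) (hh : IsPseudoInverse Q.curve h)
    {X : Set (EuclideanSpace ℝ (Fin d))} (D : Cubification X)
    {Ω : Type*} [MeasurableSpace Ω] (P : Measure Ω) [IsProbabilityMeasure P]
    (U : ℕ → Ω → I) (hU_meas : ∀ n, Measurable (U n)) (hU_indep : iIndepFun U P)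
    (hU_unif : ∀ n, P.map (U n) = volume)
    (φ : X → ℝ) (hφ : Measurable φ)
    (C γ : ℝ) (hγ : γ ∈ Set.Ioc (0 : ℝ) 1)
    (hHolder : ∀ x y : openCube d,
      |φ (D.psi.symm x) - φ (D.psi.symm y)| ≤
        C * ‖(x : EuclideanSpace ℝ (Fin d)) - (y : EuclideanSpace ℝ (Fin d))‖ ^ γ)
    (N : ℕ) [NeZero N] (z : WeightedSample X N)
    (τ : Equiv.Perm (Fin N)) (hτ : Monotone fun n => D.order h (z.pos (τ n))) :
    MemLp (fun ω => ∫ x, φ x ∂(z.orderedStrat (fun n => U n ω) τ)) 2 P ∧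
    Var[fun ω => ∫ x, φ x ∂(z.orderedStrat (fun n => U n ω) τ); P] ≤
      (2 * √((d : ℝ) + 3)) ^ (2 * γ) * C ^ 2 / (N : ℝ) ^ (1 + γ / d) := by
  obtain ⟨hγ0, hγ1⟩ := hγ
  have hd1 : (1 : ℝ) ≤ d := by exact_mod_cast hd
  have hp0 : 0 ≤ γ / d := by positivity
  have hp1 : γ / d ≤ 1 := by rw [div_le_one (by positivity)]; linarith
  have hN : (0 : ℝ) < N := by exact_mod_cast Nat.pos_of_ne_zero (NeZero.ne N)
  set K : ℝ := 2 * √((d : ℝ) + 3) with hK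
  have hK0 : 0 ≤ K := by positivity
  -- `φ` along the Hilbert order
  have hφt : ∀ x y : X, D.order h x ≤ D.order h y →
      |φ y - φ x| ≤ |C| * (K ^ γ * ((D.order h y : ℝ) - D.order h x) ^ (γ / d)) := by
    intro x y hxy
    have hnn : (0 : ℝ) ≤ (D.order h y : ℝ) - D.order h x := sub_nonneg.2 hxy
    have h1 := hHolder (D.psi y) (D.psi x)
    rw [Equiv.symm_apply_apply, Equiv.symm_apply_apply] at h1
    have h2 := Q.norm_curve_sub_le hd hxy
    have hcurve : ∀ w : X, Q.curve (D.order h w) = (D.psi w : EuclideanSpace ℝ (Fin d)) :=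
      fun w => hh.right_inv _
    rw [hcurve, hcurve, ← hK] at h2
    refine h1.trans ?_
    -- `C` is not assumed nonnegative; passing to `|C|` makes the bound monotone in the distance,
    -- and the square will remove the absolute value.
    calc _ ≤ |C| * ‖(D.psi y : EuclideanSpace ℝ (Fin d)) - D.psi x‖ ^ γ := by
          gcongr
          exact le_abs_self C
      _ ≤ |C| * (K * ((D.order h y : ℝ) - D.order h x) ^ (1 / d : ℝ)) ^ γ := by gcongr
      _ = _ := by
          rw [Real.mul_rpow hK0 (by positivity), ← Real.rpow_mul hnn, one_div_mul_eq_div]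
  -- the times of the strata's end points
  let z' := z.permute τ
  let T : ℕ → ℝ := fun n => D.order h (z'.pos (z'.invCdf ((n : ℝ) / N)))
  have hstep : ∀ n : Fin N, T n ≤ T (n + 1) := fun n => by
    refine hτ (z'.invCdf_le_invCdf ?_ ?_)
    · gcongr; simp
    · simpa using WeightedSample.stratum_le_one n.2 le_rfl
  have hT01 : ∀ n, 0 ≤ T n ∧ T n ≤ 1 := fun n => (D.order h _).2
  -- The sum telescopes to `T N - T 0`, a difference of two times in `[0,1]`.
  have hsum : ∑ n : Fin N, (T (n + 1) - T n) ≤ 1 := by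
    rw [Fin.sum_univ_eq_sum_range (fun n => T (n + 1) - T n), Finset.sum_range_sub]
    linarith [(hT01 N).2, (hT01 0).1]
  -- The centre is the value at the left end of the stratum. The drawn index is sandwiched between
  -- those of the two ends, so the bound holds for every `u`, not just on average.
  have hr : ∀ (u : ℕ → I) (n : Fin N),
      |φ (z'.pos (z'.stratIndex u n)) - φ (z'.pos (z'.invCdf ((n : ℝ) / N)))| ≤
        |C| * (K ^ γ * (T (n + 1) - T n) ^ (γ / d)) := by
    intro u n
    have hlo : z'.invCdf ((n : ℝ) / N) ≤ z'.stratIndex u n := by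
      refine z'.invCdf_le_invCdf ?_ (WeightedSample.stratum_le_one n.2 (u n).2.2)
      gcongr
      linarith [(u n).2.1]
    have hhi : z'.stratIndex u n ≤ z'.invCdf (((n + 1 : ℕ) : ℝ) / N) := by
      refine z'.invCdf_le_invCdf ?_ ?_
      · push_cast
        gcongr
        exact (u n).2.2
      · simpa using WeightedSample.stratum_le_one n.2 le_rfl
    have hlo' : T n ≤ D.order h (z'.pos (z'.stratIndex u n)) := hτ hlo
    have hhi' : (D.order h (z'.pos (z'.stratIndex u n)) : ℝ) ≤ T (n + 1) := hτ hhi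
    refine (hφt _ _ (hτ hlo)).trans ?_
    gcongr
    · exact hhi'
    · exact le_rfl
  obtain ⟨hL, hV⟩ := z'.variance_integral_strat_le hφ P hU_meas hU_indep hr
  refine ⟨hL, hV.trans ?_⟩
  calc ((N : ℝ)⁻¹) ^ 2 * ∑ n : Fin N, (|C| * (K ^ γ * (T (n + 1) - T n) ^ (γ / d))) ^ 2
      ≤ ((N : ℝ)⁻¹) ^ 2 * ∑ n : Fin N, C ^ 2 * K ^ (2 * γ) * (T (n + 1) - T n) ^ (γ / d) := by
        gcongr with n
        have hnn := sub_nonneg.2 (hstep n)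
        -- Used to replace `2γ/d` by `γ/d`: for `d = 1` the former can exceed 1, where concavity
        -- fails.
        have hle : (T (n + 1) - T n) ^ (γ / d) ≤ 1 :=
          Real.rpow_le_one hnn (by linarith [(hT01 (n + 1)).2, (hT01 n).1]) hp0
        rw [mul_pow, mul_pow, sq_abs, mul_comm 2 γ, Real.rpow_mul hK0, Real.rpow_two, mul_assoc]
        gcongr
        exact pow_le_of_le_one (by positivity) hle two_ne_zero
    _ ≤ ((N : ℝ)⁻¹) ^ 2 * (C ^ 2 * K ^ (2 * γ) * (N : ℝ) ^ (1 - γ / d)) := by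
        rw [← Finset.mul_sum]
        gcongr
        exact sum_rpow_le_card_rpow (fun n => sub_nonneg.2 (hstep n)) hsum hp0 hp1
    _ = K ^ (2 * γ) * C ^ 2 / (N : ℝ) ^ (1 + γ / d) := by
        rw [Real.rpow_sub hN, Real.rpow_add hN, Real.rpow_one]
        field_simp
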